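/- **Setting.** For a function $K:X\times W\to\mathbb C$ and $\epsilon>0$, the $\epsilon$-rank of $K$ is the smallest $r$ for which there are functions $u_1,\dots,u_r:X\to\mathbb C$ and $v_1,\dots,v_r:W\to\mathbb C$ with $|K(x,\omega)-\sum_{l=1}^r u_l(x)\overline{v_l(\omega)}|\le\epsilon$ for all $x\in X$, $\omega\in W$; the $\epsilon$-rank of a matrix is its $\epsilon$-rank as a function on pairs of indices. Put $B_R=\{\bm x\in\mathbb R^2:\|\bm x\|\le R\}$ and $A_a^b=\{\bm\omega\in\mathbb R^2: a\le\|\bm\omega\|\le b\}$. *The transform.* Enumerate $\mathbb Z^2$ as $\bm k_1,\bm k_2,\dots$ with $\lambda_i:=\|\bm k_i\|^2$ nondecreasing (ties in any order). The functions $\phi_i(\bm x)=e^{i\,\bm k_i\cdot\bm x}$ are the Laplacian eigenfunctions of the flat torus $\mathcal M=[-\pi,\pi]^2$, with eigenvalues $\lambda_i$. For points $\bm x_1,\dots,\bm x_n\in\mathcal M$ let $\Phi\in\mathbb C^{n\times m}$, $\Phi_{ji}=\phi_i(\bm x_j)$; the manifold harmonic transform is $\bm c\mapsto\Phi\bm c$.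 *The BF-MHT.* Let $L$ be the least integer $\geq 0$ with $m\le4^L$. At level $\ell=0,\dots,L$, the rows are grouped by the $4^\ell$ boxes $\tau$ of side $2\pi/2^\ell$ of a quadtree on $\mathcal M$ (according to the box containing $\bm x_j$), and the columns by the $4^{L-\ell}$ intervals $\nu$ of length $\lambda_m/4^{L-\ell}$ of a uniform 4-ary tree on $[0,\lambda_m]$ (according to the interval containing $\lambda_i$; boxes and intervals are taken half-open, closed on the left, with the last ones closed, and all columns lie in the first interval if $\lambda_m=0$). Let $r_\epsilon(\tau,\nu)$ be the $\epsilon$-rank of the block $\Phi(\tau,\nu)$. A BF-MHT (row-wise butterfly factorization with tolerance $\epsilon$) consists of: for every interval $\nu$ at level $0$ a row basis $V_\nu$ of size $|\nu|\times r_\epsilon(:,\nu)$, where $:$ denotes all rows; for every block $(\tau,\nu)$ at a level $\ell\in\{1,\dots,L\}$ a transfer matrix $R_{\tau\nu}$ of size $\big(\sum_c r_\epsilon(p,c)\big)\times r_\epsilon(\tau,\nu)$, where $p$ is the parent of $\tau$ and $c$ runs over the children of $\nu$; and for every box $\tau$ at level $L$ a column basis $U_\tau$ of size $|\tau|\times r_\epsilon(\tau,:)$,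 where $:$ denotes all columns. It is applied to $\bm c\in\mathbb C^m$ by computing $y_\nu=V_\nu^*\bm c(\nu)$ at level $0$, then $y_{\tau\nu}=R_{\tau\nu}^*\,(y_{pc})_c$ at levels $1,\dots,L$ (with $y_{pc}=y_c$ when $p$ is the root box), and finally $U_\tau\, y_{\tau,:}$ as the output on the points in $\tau$ (for $L=0$, $y_{\tau,:}$ is the level-$0$ vector). The cost to store it is the total number of entries of these matrices; the cost to apply it is the number of additions and multiplications in the matrix-vector products, counted as two operations per matrix entry. These costs depend only on the sizes of the matrices, not on their entries. **Lemma.** Let $\epsilon>0$ and $C_2\in\mathbb R$. There is a constant $C_3>0$, depending only on $\epsilon$ and $C_2$, such that the following holds. Let $C_1>0$ be such that, for all $0\le a\le b\le C_1$ and $0<R\le\sqrt2\,\pi$ with $(b-a)R<1$ and $bR\ge1$, the $\epsilon$-rank $r_\epsilon$ of the Fourier kernel $K(\bm x,\bm\omega)=e^{i\bm\omega\cdot\bm x}$, $\bm x\in B_R$, $\bm\omega\in A_a^b$, satisfies $$r_\epsilon\le C_2\,(bR)^{2/3}.$$ Then for all integers $m,n\ge0$ with $m\le C_1^2/\pi$,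 every enumeration as above and all points $\bm x_1,\dots,\bm x_n\in\mathcal M$, the cost to store any BF-MHT with tolerance $\epsilon$ for the first $m$ eigenfunctions at these $n$ points, and the cost to apply it to any $\bm c\in\mathbb C^m$, are each at most $$C_3\big(n+m^{3/2}\big).$$ -/

import Mathlib

open scoped Matrix

noncomputable section

/-! ### The `ε`-rank of a kernel -/

/-- `K` agrees up to `ε`, uniformly, with a sum of `r` separated terms `u x * conj (v ω)`. -/
def HasSeparatedApprox {X W : Type*} (ε : ℝ) (K : X → W → ℂ) (r : ℕ) : Prop :=
  ∃ (u : Fin r → X → ℂ) (v : Fin r → W → ℂ),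
    ∀ x ω, ‖K x ω - ∑ l, u l x * (starRingEnd ℂ) (v l ω)‖ ≤ ε

/-- The `ε`-rank of a kernel: the least number of terms of a separated approximation with uniform
error at most `ε` (and `⊤` if there is none). A matrix is a kernel on its index sets. -/
def epsRank {X W : Type*} (ε : ℝ) (K : X → W → ℂ) : ℕ∞ :=
  ⨅ (r : ℕ) (_ : HasSeparatedApprox ε K r), (r : ℕ∞)

/-- A kernel with finitely many frequencies has finite `ε`-rank. -/
theorem epsRank_le_card {X W : Type*} [Fintype W] {ε : ℝ} (hε : 0 ≤ ε) (K : X → W → ℂ) :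
    epsRank ε K ≤ (Fintype.card W : ℕ∞) := by
  classical
  refine iInf₂_le (Fintype.card W)
    ⟨fun l x => K x ((Fintype.equivFin W).symm l),
      fun l ω => if (Fintype.equivFin W).symm l = ω then 1 else 0, fun x ω => ?_⟩
  have h : ∑ l, K x ((Fintype.equivFin W).symm l) *
      (starRingEnd ℂ) (if (Fintype.equivFin W).symm l = ω then 1 else 0) = K x ω := by
    rw [Equiv.sum_comp (Fintype.equivFin W).symm
      (fun w => K x w * (starRingEnd ℂ) (if w = ω then 1 else 0))]
    simp [apply_ite (starRingEnd ℂ)]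
  rw [h]
  simpa using hε

/-! ### The annulus-to-disk Fourier kernel -/

/-- The plane with its Euclidean norm. -/
abbrev Plane : Type := EuclideanSpace ℝ (Fin 2)

/-- The Fourier kernel `exp (i ω · x)`. -/
def fourierKernel (x ω : Plane) : ℂ :=
  Complex.exp (Complex.I * ((inner ℝ ω x : ℝ) : ℂ))

/-- The closed annulus `a ≤ ‖ω‖ ≤ b`. -/
def annulus (a b : ℝ) : Set Plane := {ω | a ≤ ‖ω‖ ∧ ‖ω‖ ≤ b}

/-- The `ε`-rank of the Fourier kernel from the annulus with radii `a ≤ b` to the disk of radius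
`R` about the origin. -/
def annulusDiskRank (ε a b R : ℝ) : ℕ∞ :=
  epsRank ε (fun (x : Metric.closedBall (0 : Plane) R) (ω : annulus a b) =>
    fourierKernel (x : Plane) (ω : Plane))

/-- The assumed rank growth: for outer radii `b ≤ C₁` and narrow annuli the `ε`-rank is at most
`C₂ (b R) ^ (2/3)`. The radius `R` is at most that of a disk containing `[-π, π]²`, and
`b R ≥ 1`, since the rank is a positive integer as soon as `ε < 1`. -/
def AnnulusDiskRankBound (ε C₁ C₂ : ℝ) : Prop :=
  ∀ a b R : ℝ, 0 ≤ a → a ≤ b → b ≤ C₁ → 0 < R → R ≤ √2 * Real.pi → (b - a) * R < 1 →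
    1 ≤ b * R →
    (annulusDiskRank ε a b R : ENNReal) ≤ ENNReal.ofReal (C₂ * (b * R) ^ (2 / 3 : ℝ))

/-! ### Computations with a step count -/

/-- A value together with the number of arithmetic operations used to compute it. -/
structure Counted (α : Type*) where
  val : α
  steps : ℕ

/-- Run one computation and then another one that uses its result. -/
def Counted.bind {α β : Type*} (a : Counted α) (f : α → Counted β) : Counted β :=
  ⟨(f a.val).val, a.steps + (f a.val).steps⟩

/-- Run a finite family of computations. -/
def Counted.all {ι : Type*} [Fintype ι] {β : ι → Type*} (f : ∀ i, Counted (β i)) :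
    Counted (∀ i, β i) :=
  ⟨fun i => (f i).val, ∑ i, (f i).steps⟩

/-- Dense matrix-vector product: one multiplication and one addition per entry. -/
def matVec {ι κ : Type*} [Fintype ι] [Fintype κ] (A : Matrix ι κ ℂ) (v : κ → ℂ) :
    Counted (ι → ℂ) :=
  ⟨A *ᵥ v, 2 * (Fintype.card ι * Fintype.card κ)⟩

/-- The number of entries stored for a dense matrix. -/
def entries {ι κ : Type*} [Fintype ι] [Fintype κ] (_A : Matrix ι κ ℂ) : ℕ :=
  Fintype.card ι * Fintype.card κ

/-! ### The complementary trees

At level `ℓ = 0, …, L` the blocks pair the `4 ^ ℓ` boxes of depth `ℓ` of a quadtree in space with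
the `4 ^ (L - ℓ)` intervals of depth `L - ℓ` of a 4-ary tree in frequency. -/

/-- Boxes of the space quadtree at level `ℓ`. -/
abbrev SpaceBox (l : ℕ) : Type := Fin (2 ^ l) × Fin (2 ^ l)

/-- Intervals of the frequency tree at level `ℓ`. -/
abbrev FreqBox (L l : ℕ) : Type := Fin (4 ^ (L - l))

/-- The parent of a space box. -/
def SpaceBox.parent {l : ℕ} (t : SpaceBox (l + 1)) : SpaceBox l :=
  (⟨t.1 / 2, by have h := t.1.isLt; have e := pow_succ 2 l; omega⟩,
    ⟨t.2 / 2, by have h := t.2.isLt; have e := pow_succ 2 l; omega⟩)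

/-- The parent of a frequency interval. -/
def FreqBox.parent {L l : ℕ} (c : FreqBox L l) : FreqBox L (l + 1) :=
  ⟨c / 4, by
    have hc := c.isLt
    rcases Nat.lt_or_ge l L with h | h
    · have e : L - l = (L - (l + 1)) + 1 := by omega
      have e' : 4 ^ (L - l) = 4 ^ (L - (l + 1)) * 4 := by rw [e, pow_succ]
      omega
    · have e : L - l = 0 := by omega
      have e' : 4 ^ (L - l) = 1 := by rw [e, pow_zero]
      have : 0 < 4 ^ (L - (l + 1)) := by positivity
      omega⟩

/-- The root of the frequency tree, reached at level `L`. -/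
def FreqBox.root (L : ℕ) : FreqBox L L := ⟨0, by positivity⟩

/-! ### Row-wise butterfly factorizations -/

/-- A row-wise butterfly factorization with row indices `I`, column indices `J`, index trees given
by the box that contains an index at each level, and block ranks `r`. It consists of
* row bases `V` of the block columns at level `0`,
* transfer matrices `R` at level `l + 1`, with one block of rows for every child `c` of the
  frequency interval `ν`, of size the rank of the block formed by `c` and the parent of the space
  box `τ`, and with as many columns as the rank of the block `(τ, ν)`,
* column bases `U` at the last level. -/
structure ButterflyFactorization {I J : Type} [Fintype I] [Fintype J] (L : ℕ)
    (rowBox : ∀ l : ℕ, I → SpaceBox l) (colBox : ∀ l : ℕ, J → FreqBox L l)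
    (r : ∀ l : ℕ, SpaceBox l → FreqBox L l → ℕ) where
  V : ∀ (τ : SpaceBox 0) (ν : FreqBox L 0),
    Matrix {k : J // colBox 0 k = ν} (Fin (r 0 τ ν)) ℂ
  R : ∀ (l : ℕ) (τ : SpaceBox (l + 1)) (ν : FreqBox L (l + 1)),
    Matrix ((c : {c : FreqBox L l // c.parent = ν}) × Fin (r l τ.parent c.1))
      (Fin (r (l + 1) τ ν)) ℂ
  U : ∀ τ : SpaceBox L,
    Matrix {j : I // rowBox L j = τ} (Fin (r L τ (FreqBox.root L))) ℂ

namespace ButterflyFactorization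

variable {I J : Type} [Fintype I] [Fintype J] {L : ℕ} {rowBox : ∀ l : ℕ, I → SpaceBox l}
  {colBox : ∀ l : ℕ, J → FreqBox L l} {r : ∀ l : ℕ, SpaceBox l → FreqBox L l → ℕ}

/-- The number of stored matrix entries: row bases at level `0`, transfer matrices at levels
`1, …, L`, column bases at level `L`. -/
def storage (F : ButterflyFactorization L rowBox colBox r) : ℕ :=
  (∑ τ, ∑ ν, entries (F.V τ ν)) +
    (∑ l ∈ Finset.range L, ∑ τ, ∑ ν, entries (F.R l τ ν)) +
    ∑ τ, entries (F.U τ)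

/-- The coefficients of all blocks of level `l` in their column bases, computed level by level:
first with the row bases, then with the transfer matrices. -/
def coefficients (F : ButterflyFactorization L rowBox colBox r) (c : J → ℂ) :
    ∀ l : ℕ, Counted (∀ (τ : SpaceBox l) (ν : FreqBox L l), Fin (r l τ ν) → ℂ)
  | 0 => Counted.all fun τ => Counted.all fun ν => matVec (F.V τ ν)ᴴ (fun k => c k.1)
  | l + 1 => (F.coefficients c l).bind fun y =>
      Counted.all fun τ => Counted.all fun ν =>
        matVec (F.R l τ ν)ᴴ (fun q => y τ.parent q.1.1 q.2)

/-- The butterfly matrix-vector product. -/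
def apply (F : ButterflyFactorization L rowBox colBox r) (c : J → ℂ) : Counted (I → ℂ) :=
  (F.coefficients c L).bind fun y =>
    (Counted.all fun τ => matVec (F.U τ) (y τ (FreqBox.root L))).bind fun f =>
      ⟨fun j => f (rowBox L j) ⟨j, rfl⟩, 0⟩

end ButterflyFactorization

/-! ### The manifold harmonic transform on the flat torus `[-π, π]²` -/

/-- The Laplacian eigenfunction `exp (i (k₁ x₁ + k₂ x₂))`. -/
def torusEigenfunction (k : ℤ × ℤ) (x : Plane) : ℂ :=
  Complex.exp (Complex.I * ((k.1 : ℂ) * (x 0 : ℂ) + (k.2 : ℂ) * (x 1 : ℂ)))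

/-- Its eigenvalue `k₁² + k₂²`. -/
def torusEigenvalue (k : ℤ × ℤ) : ℝ := (k.1 : ℝ) ^ 2 + (k.2 : ℝ) ^ 2

/-- The matrix `Φ j k = φ_k (x_j)` of the transform for the first `m` eigenfunctions in the
enumeration `e`. -/
def mhtMatrix (e : ℕ ≃ ℤ × ℤ) (m : ℕ) {n : ℕ} (x : Fin n → Plane) :
    Matrix (Fin n) (Fin m) ℂ :=
  fun j k => torusEigenfunction (e k) (x j)

/-- The cell `[q / N, (q + 1) / N)` of `[0, 1]` that contains `s` (the last cell is closed). -/
def unitCell (N : ℕ) (hN : 0 < N) (s : ℝ) : Fin N :=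
  ⟨min ⌊(N : ℝ) * s⌋₊ (N - 1), by omega⟩

/-- The box of the quadtree on `[-π, π]²` that contains `x`; at level `l` the boxes have side
`2 π / 2 ^ l`. -/
def spaceBox (l : ℕ) (x : Plane) : SpaceBox l :=
  (unitCell (2 ^ l) (by positivity) ((x 0 + Real.pi) / (2 * Real.pi)),
    unitCell (2 ^ l) (by positivity) ((x 1 + Real.pi) / (2 * Real.pi)))

/-- The interval of the uniform 4-ary tree on `[0, Λ]` that contains `t`; at level `l` the
intervals have length `Λ / 4 ^ (L - l)`. -/
def freqBox (L : ℕ) (Λ : ℝ) (l : ℕ) (t : ℝ) : FreqBox L l :=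
  unitCell (4 ^ (L - l)) (by positivity) (t / Λ)

/-- The number of levels: the least `L` with `m ≤ 4 ^ L`. -/
def mhtLevels (m : ℕ) : ℕ := Nat.clog 4 m

/-- The space tree on the row indices. -/
def mhtRowBox {n : ℕ} (x : Fin n → Plane) (l : ℕ) (j : Fin n) : SpaceBox l :=
  spaceBox l (x j)

/-- The frequency tree on the column indices: a uniform 4-ary tree on `[0, λ_m]`, where `λ_m` is
the largest of the first `m` eigenvalues. -/
def mhtColBox (e : ℕ ≃ ℤ × ℤ) (m : ℕ) (l : ℕ) (k : Fin m) : FreqBox (mhtLevels m) l :=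
  freqBox (mhtLevels m) (torusEigenvalue (e (m - 1))) l (torusEigenvalue (e k))

/-- The `ε`-rank of the block of the transform given by a space box and a frequency interval.
It is finite for `0 ≤ ε`, see `epsRank_le_card`. -/
def mhtBlockRank (ε : ℝ) (e : ℕ ≃ ℤ × ℤ) (m : ℕ) {n : ℕ} (x : Fin n → Plane)
    (l : ℕ) (τ : SpaceBox l) (ν : FreqBox (mhtLevels m) l) : ℕ :=
  (epsRank ε (fun (j : {j : Fin n // mhtRowBox x l j = τ})
    (k : {k : Fin m // mhtColBox e m l k = ν}) => mhtMatrix e m x j.1 k.1)).toNat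

/-- Butterfly-accelerated manifold harmonic transforms: butterfly factorizations along the above
trees, all of whose factors have the sizes given by the `ε`-ranks of the blocks. -/
abbrev BFMHT (ε : ℝ) (e : ℕ ≃ ℤ × ℤ) (m : ℕ) {n : ℕ} (x : Fin n → Plane) : Type :=
  ButterflyFactorization (mhtLevels m) (mhtRowBox x) (mhtColBox e m) (mhtBlockRank ε e m x)

end

/-! ### Separated approximations -/

/-! An interval of eigenvalues is an annulus of frequencies, since the eigenvalue is the squared
length of the lattice point. Moving the center of a space box to the origin multiplies the kernel by
a unimodular function of the frequency, which a separated approximation absorbs. So each block is a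
restriction of the annulus-to-disk kernel, with `R = √2 π / 2 ^ l`. A lattice count gives `λ_m ≤ 2 m
≤ 2 * 4 ^ L`; hence the width of the annulus times `R` is at most `2 π < 7`, and its outer radius
times `R` is at most `2 π * 2 ^ (L - l)`. Cutting the annulus into seven makes the assumed bound
applicable, except where the product of the radii is below `1`, which compactness handles. With `g =
2 ^ (1/3)`, the ranks are `O(g ^ (2 (L - l)))` (`exists_mhtBlockRank_const`).

This rank bound alone is not enough: it gives `O(g ^ (10 L - 4 l))` transfer entries at level `l`,
which is of order `m ^ (5/3)` at `l = 0`. At coarse space levels the ranks in a block row are better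
controlled by the numbers of columns, which sum to `m`; this gives `O(g ^ (8 L + 4 l))`. The two
bounds cross at `l = L / 4`, with value `g ^ (9 L) = 2 ^ (3 L)`, of order `m ^ (3/2)`, and decay
geometrically away from it (`sum_transferStorage_le`). The row bases cost `O(m * g ^ (2 L))`, which
is smaller, and the column bases `O(n)`. -/

theorem HasSeparatedApprox.of_fintype {X W ι : Type*} [Fintype ι] {ε : ℝ} {K : X → W → ℂ}
    (u : ι → X → ℂ) (v : ι → W → ℂ)
    (h : ∀ x ω, ‖K x ω - ∑ l, u l x * (starRingEnd ℂ) (v l ω)‖ ≤ ε) :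
    HasSeparatedApprox ε K (Fintype.card ι) := by
  refine ⟨fun l => u ((Fintype.equivFin ι).symm l), fun l => v ((Fintype.equivFin ι).symm l),
    fun x ω => ?_⟩
  rw [Equiv.sum_comp (Fintype.equivFin ι).symm (fun l => u l x * (starRingEnd ℂ) (v l ω))]
  exact h x ω

theorem HasSeparatedApprox.comp {X W X' W' : Type*} {ε : ℝ} {K : X → W → ℂ} {r : ℕ}
    (h : HasSeparatedApprox ε K r) {K' : X' → W' → ℂ} (f : X' → X) (g : W' → W)
    (hK : ∀ x ω, K' x ω = K (f x) (g ω)) : HasSeparatedApprox ε K' r := by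
  obtain ⟨u, v, h⟩ := h
  exact ⟨fun l x => u l (f x), fun l ω => v l (g ω), fun x ω => by rw [hK]; exact h _ _⟩

theorem HasSeparatedApprox.mul_unimodular {X W : Type*} {ε : ℝ} {K : X → W → ℂ} {r : ℕ}
    (h : HasSeparatedApprox ε K r) (g : W → ℂ) (hg : ∀ ω, ‖g ω‖ = 1) :
    HasSeparatedApprox ε (fun x ω => K x ω * g ω) r := by
  obtain ⟨u, v, h⟩ := h
  refine ⟨u, fun l ω => v l ω * (starRingEnd ℂ) (g ω), fun x ω => ?_⟩
  have e : K x ω * g ω - ∑ l, u l x * (starRingEnd ℂ) (v l ω * (starRingEnd ℂ) (g ω)) =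
      (K x ω - ∑ l, u l x * (starRingEnd ℂ) (v l ω)) * g ω := by
    simp only [map_mul, Complex.conj_conj, sub_mul, Finset.sum_mul, mul_assoc]
  rw [e, norm_mul, hg, mul_one]
  exact h x ω

/-- Extending each `v` by zero off its class leaves a single class active at every frequency, so the
ranks add but the errors do not. -/
theorem HasSeparatedApprox.of_partition {X W ι : Type*} [Fintype ι] {ε : ℝ} {K : X → W → ℂ}
    (p : W → ι) (r : ι → ℕ)
    (h : ∀ i, HasSeparatedApprox ε (fun x (ω : {ω // p ω = i}) => K x ω) (r i)) :
    HasSeparatedApprox ε K (∑ i, r i) := by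
  classical
  choose u v h using h
  have key := HasSeparatedApprox.of_fintype (ε := ε) (K := K)
    (fun (q : (i : ι) × Fin (r i)) x => u q.1 q.2 x)
    (fun q ω => if hq : p ω = q.1 then v q.1 q.2 ⟨ω, hq⟩ else 0) (fun x ω => ?_)
  · simpa using key
  · rw [Fintype.sum_sigma, Finset.sum_eq_single (p ω)]
    · simpa using h (p ω) x ⟨ω, rfl⟩
    · intro i _ hi
      simp [hi.symm]
    · simp

theorem HasSeparatedApprox.epsRank_le {X W : Type*} {ε : ℝ} {K : X → W → ℂ} {r : ℕ}
    (h : HasSeparatedApprox ε K r) : epsRank ε K ≤ r :=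
  iInf₂_le r h

theorem HasSeparatedApprox.toNat_epsRank_le {X W : Type*} {ε : ℝ} {K : X → W → ℂ} {r : ℕ}
    (h : HasSeparatedApprox ε K r) : (epsRank ε K).toNat ≤ r :=
  ENat.toNat_le_of_le_natCast h.epsRank_le

theorem exists_hasSeparatedApprox_of_epsRank_le {X W : Type*} {ε y : ℝ} {K : X → W → ℂ}
    (hy : 0 ≤ y) (h : (epsRank ε K : ENNReal) ≤ ENNReal.ofReal y) :
    ∃ r : ℕ, HasSeparatedApprox ε K r ∧ (r : ℝ) ≤ y := by
  by_contra! hc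
  have h1 : ((⌊y⌋₊ + 1 : ℕ) : ℕ∞) ≤ epsRank ε K := by
    refine le_iInf₂ fun r hr => ?_
    exact_mod_cast Nat.succ_le_of_lt ((Nat.floor_lt hy).2 (hc r hr))
  have h2 : (((⌊y⌋₊ + 1 : ℕ) : ℕ∞) : ENNReal) ≤ ENNReal.ofReal y :=
    (ENat.toENNReal_le.2 h1).trans h
  rw [ENat.toENNReal_coe, ← ENNReal.ofReal_natCast, ENNReal.ofReal_le_ofReal_iff hy] at h2
  have := Nat.lt_floor_add_one y
  push_cast at h2
  linarith

/-! ### Cells of uniform subdivisions -/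

theorem unitCell_mem {N : ℕ} (hN : 0 < N) {A B t : ℝ} (hA : A ≤ t) (hB : t ≤ B) :
    A + (B - A) * ((unitCell N hN ((t - A) / (B - A)) : ℕ) / N) ≤ t ∧
      t ≤ A + (B - A) * (((unitCell N hN ((t - A) / (B - A)) : ℕ) + 1) / N) := by
  have hN' : (0 : ℝ) < N := by exact_mod_cast hN
  set s := (t - A) / (B - A) with hs
  have hs0 : 0 ≤ s := div_nonneg (by linarith) (by linarith)
  have hs1 : s ≤ 1 := div_le_one_of_le₀ (by linarith) (by linarith)
  have ht : t = A + (B - A) * s := by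
    -- For `A = B` the quotient is `0` by convention, and the cell is the single point `A`.
    rcases eq_or_ne (B - A) 0 with h | h
    · rw [h]; linarith
    · rw [hs]; field_simp; ring
  have hcell : ((unitCell N hN s : ℕ) : ℝ) ≤ N * s ∧ (N : ℝ) * s ≤ (unitCell N hN s : ℕ) + 1 := by
    have hval : (unitCell N hN s : ℕ) = min ⌊(N : ℝ) * s⌋₊ (N - 1) := rfl
    have hfl := Nat.floor_le (mul_nonneg hN'.le hs0)
    have hfu := (Nat.lt_floor_add_one ((N : ℝ) * s)).le
    rw [hval]
    rcases min_cases ⌊(N : ℝ) * s⌋₊ (N - 1) with ⟨h, _⟩ | ⟨h, h'⟩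
    · rw [h]; exact ⟨hfl, hfu⟩
    · rw [h]
      constructor
      · refine le_trans ?_ hfl
        exact_mod_cast h'.le
      · rw [Nat.cast_sub hN]
        push_cast
        nlinarith
  have hBA : 0 ≤ B - A := by linarith
  have h1 : ((unitCell N hN s : ℕ) : ℝ) / N ≤ s := by
    rw [div_le_iff₀ hN']; linarith [hcell.1]
  have h2 : s ≤ (((unitCell N hN s : ℕ) : ℝ) + 1) / N := by
    rw [le_div_iff₀ hN']; linarith [hcell.2]
  constructor
  · conv_rhs => rw [ht]
    gcongr
  · conv_lhs => rw [ht]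
    gcongr

/-! ### The rank of the Fourier kernel on annuli -/

theorem norm_fourierKernel (x ω : Plane) : ‖fourierKernel x ω‖ = 1 := by
  rw [fourierKernel, mul_comm, Complex.norm_exp_ofReal_mul_I]

theorem fourierKernel_add_left (x y ω : Plane) :
    fourierKernel (x + y) ω = fourierKernel x ω * fourierKernel y ω := by
  simp only [fourierKernel, inner_add_right, Complex.ofReal_add, mul_add, Complex.exp_add]

theorem fourierKernel_add_right (x ω η : Plane) :
    fourierKernel x (ω + η) = fourierKernel x ω * fourierKernel x η := by
  simp only [fourierKernel, inner_add_left, Complex.ofReal_add, mul_add, Complex.exp_add]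

theorem norm_fourierKernel_sub_le (x ω η : Plane) :
    ‖fourierKernel x ω - fourierKernel x η‖ ≤ ‖ω - η‖ * ‖x‖ := by
  have e : fourierKernel x ω - fourierKernel x η =
      fourierKernel x η * (fourierKernel x (ω - η) - 1) := by
    rw [mul_sub, ← fourierKernel_add_right, mul_one, add_sub_cancel]
  rw [e, norm_mul, norm_fourierKernel, one_mul]
  refine (Real.norm_exp_I_mul_ofReal_sub_one_le).trans ?_
  exact abs_real_inner_le_norm _ _

/-- If the product of the radii is at most `1`, the kernel is approximated by finitely many of its
columns, in number depending on `ε` only. -/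
theorem exists_hasSeparatedApprox_of_mul_le_one {ε : ℝ} (hε : 0 < ε) :
    ∃ N : ℕ, ∀ a b R : ℝ, 0 < R → b * R ≤ 1 →
      HasSeparatedApprox ε (fun (x : Metric.closedBall (0 : Plane) R) (ω : annulus a b) =>
        fourierKernel (x : Plane) (ω : Plane)) N := by
  -- The rescaled frequencies `R • ω` lie in the unit disk, and `t` is an `ε`-net there. The kernel
  -- is Lipschitz in `ω` with constant `‖x‖ ≤ R`, so replacing `ω` by `R⁻¹ • y` costs at most `R⁻¹ *
  -- ε * R = ε`.
  obtain ⟨t, ht, hcov⟩ := Metric.totallyBounded_iff.1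
    (isCompact_closedBall (0 : Plane) 1).totallyBounded ε hε
  have := ht.fintype
  refine ⟨∑ _i : t, 1, fun a b R hR hbR => ?_⟩
  have hmem : ∀ ω : annulus a b, ∃ y : t, ‖R • (ω : Plane) - y‖ < ε := fun ω => by
    have h1 : R • (ω : Plane) ∈ Metric.closedBall (0 : Plane) 1 := by
      rw [mem_closedBall_zero_iff, norm_smul, Real.norm_of_nonneg hR.le]
      nlinarith [ω.2.2]
    obtain ⟨y, hy, hy'⟩ := Set.mem_iUnion₂.1 (hcov h1)
    exact ⟨⟨y, hy⟩, by rwa [mem_ball_iff_norm] at hy'⟩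
  choose p hp using hmem
  refine HasSeparatedApprox.of_partition p _ fun y =>
    ⟨fun _ x => fourierKernel x (R⁻¹ • (y : Plane)), fun _ _ => 1, fun x ω => ?_⟩
  simp only [map_one, mul_one, Finset.univ_unique, Finset.sum_const, Finset.card_singleton,
    one_smul]
  refine (norm_fourierKernel_sub_le _ _ _).trans ?_
  have h2 : ‖R • (ω.1 : Plane) - y‖ < ε := by
    have := hp ω.1
    rwa [ω.2] at this
  have h3 : (ω.1 : Plane) - R⁻¹ • (y : Plane) = R⁻¹ • (R • (ω.1 : Plane) - y) := by
    rw [smul_sub, inv_smul_smul₀ hR.ne']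
  have h4 : ‖(x : Plane)‖ ≤ R := mem_closedBall_zero_iff.1 x.2
  rw [h3, norm_smul, Real.norm_of_nonneg (inv_nonneg.2 hR.le)]
  calc R⁻¹ * ‖R • (ω.1 : Plane) - y‖ * ‖(x : Plane)‖ ≤ R⁻¹ * ε * R := by gcongr
    _ = ε := by field_simp

/-- Wider annuli, and those with small outer radius. -/
theorem exists_annulus_rank_const (ε C₂ : ℝ) (hε : 0 < ε) :
    ∃ C : ℝ, 0 ≤ C ∧ ∀ C₁ : ℝ, AnnulusDiskRankBound ε C₁ C₂ → ∀ a b R : ℝ, 0 ≤ a → a ≤ b →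
      b ≤ C₁ → 0 < R → R ≤ √2 * Real.pi → (b - a) * R < 7 →
      ∃ r : ℕ, HasSeparatedApprox ε (fun (x : Metric.closedBall (0 : Plane) R)
        (ω : annulus a b) => fourierKernel (x : Plane) (ω : Plane)) r ∧
        (r : ℝ) ≤ C * max 1 ((b * R) ^ (2 / 3 : ℝ)) := by
  obtain ⟨N, hN⟩ := exists_hasSeparatedApprox_of_mul_le_one hε
  -- Seven subannuli of equal width, each of rank at most `N` by compactness or bounded through
  -- `C₂`, which may be negative.
  refine ⟨7 * (N + max C₂ 0), by positivity, fun C₁ hC a b R ha hab hb hR hR' hlt => ?_⟩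
  have hC₂ : 0 ≤ max C₂ 0 := le_max_right _ _
  have hM : (1 : ℝ) ≤ max 1 ((b * R) ^ (2 / 3 : ℝ)) := le_max_left _ _
  have hpiece : ∀ i : Fin 7, ∃ r : ℕ, HasSeparatedApprox ε
      (fun (x : Metric.closedBall (0 : Plane) R)
        (ω : annulus (a + (b - a) * ((i : ℕ) / (7 : ℕ))) (a + (b - a) * (((i : ℕ) + 1) / (7 : ℕ)))) =>
        fourierKernel (x : Plane) (ω : Plane)) r ∧
      (r : ℝ) ≤ (N + max C₂ 0) * max 1 ((b * R) ^ (2 / 3 : ℝ)) := fun i => by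
    have hi : ((i : ℕ) : ℝ) + 1 ≤ 7 := by exact_mod_cast i.isLt
    have hi0 : (0 : ℝ) ≤ ((i : ℕ) : ℝ) := by positivity
    have hba : 0 ≤ b - a := by linarith
    have hN0 : (0 : ℝ) ≤ N := by positivity
    set a' := a + (b - a) * (((i : ℕ) : ℝ) / (7 : ℕ)) with ha'
    set b' := a + (b - a) * ((((i : ℕ) : ℝ) + 1) / (7 : ℕ)) with hb'
    have e : b' - a' = (b - a) / 7 := by rw [ha', hb']; push_cast; ring
    have ha0 : 0 ≤ a' := by positivity
    have hb'b : b' ≤ b := by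
      rw [hb']; push_cast; nlinarith
    have hb'0 : 0 ≤ b' := by linarith
    rcases le_or_gt (b' * R) 1 with h | h
    · exact ⟨N, hN _ _ _ hR h, by nlinarith⟩
    · have h1 := hC a' b' R ha0 (by linarith) (by linarith) hR hR'
        (by rw [e]; linarith) h.le
      obtain ⟨r, hr, hr'⟩ := exists_hasSeparatedApprox_of_epsRank_le
        (y := max C₂ 0 * (b' * R) ^ (2 / 3 : ℝ)) (by positivity)
        (h1.trans (ENNReal.ofReal_le_ofReal (by gcongr; exact le_max_left _ _)))
      refine ⟨r, hr, hr'.trans ?_⟩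
      have h2 : (b' * R) ^ (2 / 3 : ℝ) ≤ max 1 ((b * R) ^ (2 / 3 : ℝ)) :=
        le_max_of_le_right (by gcongr)
      nlinarith
  choose r hr hr' using hpiece
  refine ⟨∑ i, r i, ?_, ?_⟩
  · refine HasSeparatedApprox.of_partition
      (fun ω : annulus a b => unitCell 7 (by norm_num) ((‖(ω : Plane)‖ - a) / (b - a))) r
      fun i => ?_
    refine (hr i).comp id (fun ω => ⟨ω.1.1, ?_⟩) fun _ _ => rfl
    have h := unitCell_mem (N := 7) (by norm_num) ω.1.2.1 ω.1.2.2
    rw [ω.2] at h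
    exact h
  · push_cast
    refine (Finset.sum_le_sum fun i _ => hr' i).trans ?_
    simp [mul_assoc]

/-! ### The eigenvalues and eigenfunctions of the torus -/

/-- The point of the plane with the given integer coordinates. -/
def latticePoint (k : ℤ × ℤ) : Plane := !₂[(k.1 : ℝ), (k.2 : ℝ)]

theorem torusEigenfunction_eq (k : ℤ × ℤ) (x : Plane) :
    torusEigenfunction k x = fourierKernel x (latticePoint k) := by
  simp [torusEigenfunction, fourierKernel, latticePoint, PiLp.inner_apply, Fin.sum_univ_two,
    mul_comm]

theorem norm_latticePoint (k : ℤ × ℤ) : ‖latticePoint k‖ = √(torusEigenvalue k) := by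
  simp [EuclideanSpace.norm_eq, latticePoint, torusEigenvalue, Fin.sum_univ_two]

theorem torusEigenvalue_nonneg (k : ℤ × ℤ) : 0 ≤ torusEigenvalue k := by
  unfold torusEigenvalue
  positivity

/-- The points of a square inscribed in the open disk come earlier in the enumeration. -/
theorem torusEigenvalue_le_two_mul (e : ℕ ≃ ℤ × ℤ)
    (he : Monotone fun k => torusEigenvalue (e k)) (k : ℕ) :
    torusEigenvalue (e k) ≤ 2 * k := by
  set Λ := torusEigenvalue (e k) with hΛ
  rcases (torusEigenvalue_nonneg (e k)).eq_or_lt with h0 | h0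
  · rw [hΛ, ← h0]; positivity
  set t := √(Λ / 2) with ht
  have ht0 : 0 < t := Real.sqrt_pos.2 (by positivity)
  have ht2 : t ^ 2 = Λ / 2 := Real.sq_sqrt (by positivity)
  -- `s` is the largest integer strictly below `t`. The `(2 s + 1) ^ 2` lattice points with
  -- coordinates at most `s` in absolute value have eigenvalue at most `2 s ^ 2 < Λ`, so they
  -- precede `e k`. Then `Λ = 2 t ^ 2 ≤ 2 (s + 1) ^ 2 ≤ 2 (2 s + 1) ^ 2 ≤ 2 k`.
  obtain ⟨s, hs⟩ : ∃ s : ℕ, ⌈t⌉₊ = s + 1 :=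
    Nat.exists_eq_succ_of_ne_zero (Nat.ceil_pos.2 ht0).ne'
  have hst : (s : ℝ) < t := Nat.lt_ceil.1 (by omega)
  have hts : t ≤ s + 1 := by
    have := Nat.le_ceil t
    rw [hs] at this
    exact_mod_cast this
  have hcard : (Finset.Icc (-(s : ℤ)) s ×ˢ Finset.Icc (-(s : ℤ)) s).card ≤
      (Finset.range k).card := by
    refine Finset.card_le_card_of_injOn e.symm (fun p hp => ?_) e.symm.injective.injOn
    simp only [Finset.coe_product, Set.mem_prod, Finset.coe_Icc, Set.mem_Icc] at hp
    simp only [Finset.coe_range, Set.mem_Iio]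
    by_contra! hk
    have h1 := he hk
    simp only [Equiv.apply_symm_apply] at h1
    have hsq : ∀ z : ℤ, -(s : ℤ) ≤ z ∧ z ≤ s → (z : ℝ) ^ 2 ≤ (s : ℝ) ^ 2 := fun z hz =>
      sq_le_sq' (by exact_mod_cast hz.1) (by exact_mod_cast hz.2)
    have h2 : torusEigenvalue p ≤ 2 * (s : ℝ) ^ 2 := by
      unfold torusEigenvalue
      linarith [hsq _ hp.1, hsq _ hp.2]
    have h3 : (s : ℝ) ^ 2 < t ^ 2 := by gcongr
    linarith
  rw [Finset.card_product, Int.card_Icc, Finset.card_range] at hcard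
  have h4 : (2 * s + 1) * (2 * s + 1) ≤ k := by
    have : ((s : ℤ) + 1 - -(s : ℤ)).toNat = 2 * s + 1 := by omega
    rwa [this] at hcard
  have h5 : ((2 * s + 1) * (2 * s + 1) : ℝ) ≤ k := by exact_mod_cast h4
  have h6 : t ^ 2 ≤ ((s : ℝ) + 1) ^ 2 := by gcongr
  nlinarith

/-! ### The ranks of the blocks -/

/-- The center of a box of the quadtree. -/
noncomputable def boxCenter (l : ℕ) (τ : SpaceBox l) : Plane :=
  !₂[-Real.pi + 2 * Real.pi * (((τ.1 : ℕ) + 1 / 2) / 2 ^ l),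
    -Real.pi + 2 * Real.pi * (((τ.2 : ℕ) + 1 / 2) / 2 ^ l)]

theorem norm_sub_boxCenter_le (l : ℕ) (x : Plane)
    (hx : ∀ i, x i ∈ Set.Icc (-Real.pi) Real.pi) :
    ‖x - boxCenter l (spaceBox l x)‖ ≤ √2 * Real.pi / 2 ^ l := by
  have hcoord : ∀ t ∈ Set.Icc (-Real.pi) Real.pi,
      (t - (-Real.pi + 2 * Real.pi * (((unitCell (2 ^ l) (by positivity)
        ((t + Real.pi) / (2 * Real.pi)) : ℕ) + 1 / 2) / 2 ^ l))) ^ 2 ≤ (Real.pi / 2 ^ l) ^ 2 := by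
    intro t ht
    have h := unitCell_mem (N := 2 ^ l) (by positivity) ht.1 ht.2
    rw [show t - -Real.pi = t + Real.pi by ring,
      show Real.pi - -Real.pi = 2 * Real.pi by ring] at h
    push_cast at h
    refine sq_le_sq' ?_ ?_
    · refine le_trans (le_of_eq ?_) (sub_le_sub_right h.1 _)
      ring
    · refine (sub_le_sub_right h.2 _).trans (le_of_eq ?_)
      ring
  rw [EuclideanSpace.norm_eq, Fin.sum_univ_two]
  refine Real.sqrt_le_iff.2 ⟨by positivity, ?_⟩
  have h0 := hcoord _ (hx 0)
  have h1 := hcoord _ (hx 1)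
  have e : (√2 * Real.pi / 2 ^ l) ^ 2 = 2 * (Real.pi / 2 ^ l) ^ 2 := by
    rw [mul_div_assoc, mul_pow, Real.sq_sqrt (by norm_num)]
  rw [e, Real.norm_eq_abs, Real.norm_eq_abs, sq_abs, sq_abs]
  simp only [boxCenter, spaceBox, PiLp.sub_apply, Matrix.cons_val_zero,
    Matrix.cons_val_one] at h0 h1 ⊢
  linarith

theorem le_four_pow_mhtLevels (m : ℕ) : m ≤ 4 ^ mhtLevels m :=
  Nat.le_pow_clog (by norm_num) m

theorem four_pow_mhtLevels_le {m : ℕ} (hm : 0 < m) : 4 ^ mhtLevels m ≤ 4 * m := by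
  rcases Nat.lt_or_ge 1 m with h | h
  · have h1 := Nat.pow_pred_clog_lt_self (b := 4) (by norm_num) h
    have h2 : 0 < Nat.clog 4 m := Nat.clog_pos (by norm_num) h
    obtain ⟨k, hk⟩ := Nat.exists_eq_succ_of_ne_zero h2.ne'
    rw [mhtLevels, hk, Nat.succ_eq_add_one, pow_succ]
    rw [hk] at h1
    simp only [Nat.pred_eq_sub_one, Nat.succ_eq_add_one, Nat.add_sub_cancel] at h1
    omega
  · have : m = 1 := by omega
    subst this
    simp [mhtLevels]

theorem torusEigenvalue_mem_freqBox (e : ℕ ≃ ℤ × ℤ)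
    (he : Monotone fun k => torusEigenvalue (e k)) {m l : ℕ} (k : Fin m) :
    latticePoint (e k) ∈ annulus
      (√(torusEigenvalue (e (m - 1)) *
        (((mhtColBox e m l k : FreqBox (mhtLevels m) l) : ℕ) / 4 ^ (mhtLevels m - l))))
      (√(torusEigenvalue (e (m - 1)) *
        ((((mhtColBox e m l k : FreqBox (mhtLevels m) l) : ℕ) + 1) / 4 ^ (mhtLevels m - l)))) := by
  have h1 : torusEigenvalue (e k) ≤ torusEigenvalue (e (m - 1)) :=
    he (by have := k.isLt; omega)
  have h := unitCell_mem (N := 4 ^ (mhtLevels m - l)) (by positivity)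
    (torusEigenvalue_nonneg (e k)) h1
  simp only [sub_zero, zero_add] at h
  push_cast at h
  refine ⟨?_, ?_⟩
  · rw [norm_latticePoint]
    exact Real.sqrt_le_sqrt h.1
  · rw [norm_latticePoint]
    exact Real.sqrt_le_sqrt h.2

/-- The `ε`-rank of a block is at most a constant times `2 ^ ((L - l) * 2 / 3)`. -/
theorem exists_mhtBlockRank_const (ε C₂ : ℝ) (hε : 0 < ε) :
    ∃ C : ℝ, 0 ≤ C ∧ ∀ C₁ : ℝ, 0 < C₁ → AnnulusDiskRankBound ε C₁ C₂ →
      ∀ e : ℕ ≃ ℤ × ℤ, Monotone (fun k => torusEigenvalue (e k)) →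
      ∀ m n : ℕ, (m : ℝ) ≤ C₁ ^ 2 / Real.pi → ∀ x : Fin n → Plane,
      (∀ j i, x j i ∈ Set.Icc (-Real.pi) Real.pi) → ∀ l ≤ mhtLevels m, ∀ τ ν,
      (mhtBlockRank ε e m x l τ ν : ℝ) ≤
        C * ((2 : ℝ) ^ (1 / 3 : ℝ)) ^ (2 * (mhtLevels m - l)) := by
  obtain ⟨C, hC0, hC⟩ := exists_annulus_rank_const ε C₂ hε
  refine ⟨C * (2 * Real.pi) ^ (2 / 3 : ℝ), by positivity,
    fun C₁ hC₁ hb e he m n hm x hx l hl => ?_⟩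
  have hpi := Real.pi_pos
  set L := mhtLevels m with hL
  set Λ := torusEigenvalue (e (m - 1)) with hΛ
  have hΛ0 : 0 ≤ Λ := torusEigenvalue_nonneg _
  have hΛm : Λ ≤ 2 * m := by
    refine (torusEigenvalue_le_two_mul e he (m - 1)).trans ?_
    gcongr
    omega
  have hΛL : Λ ≤ 2 * 4 ^ L := by
    have : (m : ℝ) ≤ 4 ^ L := by exact_mod_cast le_four_pow_mhtLevels m
    linarith
  -- The size restriction on `m` enters here: `2 m ≤ 2 C₁ ^ 2 / π ≤ C₁ ^ 2` keeps all outer radii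
  -- below `C₁`.
  have hΛC : Λ ≤ C₁ ^ 2 := by
    rw [le_div_iff₀ hpi] at hm
    have : (2 : ℝ) ≤ Real.pi := Real.two_le_pi
    have hm0 : (0 : ℝ) ≤ m := by positivity
    nlinarith
  have hsqrt4 : √((4 : ℝ) ^ L) = 2 ^ L := by
    rw [show (4 : ℝ) ^ L = (2 ^ L) ^ 2 by rw [← pow_mul, mul_comm, pow_mul]; norm_num]
    exact Real.sqrt_sq (by positivity)
  have hsΛ : √Λ ≤ √2 * 2 ^ L := by
    rw [← hsqrt4, ← Real.sqrt_mul (by norm_num)]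
    exact Real.sqrt_le_sqrt hΛL
  intro τ ν
  have hq : ((ν : ℕ) : ℝ) + 1 ≤ 4 ^ (L - l) := by exact_mod_cast ν.isLt
  have h4 : (4 : ℝ) ^ (L - l) = (2 ^ (L - l)) ^ 2 := by
    rw [← pow_mul, mul_comm, pow_mul]; norm_num
  have h2L : (2 : ℝ) ^ L = 2 ^ (L - l) * 2 ^ l := by rw [← pow_add]; congr 1; omega
  have h22 : √2 * √2 = (2 : ℝ) := Real.mul_self_sqrt (by norm_num)
  set a := √(Λ * (((ν : ℕ) : ℝ) / 4 ^ (L - l))) with ha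
  set b := √(Λ * ((((ν : ℕ) : ℝ) + 1) / 4 ^ (L - l))) with hbdef
  set R := √2 * Real.pi / 2 ^ l with hR
  have hab : a ≤ b := Real.sqrt_le_sqrt (by gcongr; linarith)
  have hbΛ : b ≤ √Λ := Real.sqrt_le_sqrt
    (mul_le_of_le_one_right hΛ0 (div_le_one_of_le₀ hq (by positivity)))
  have hbC : b ≤ C₁ := hbΛ.trans (Real.sqrt_le_iff.2 ⟨hC₁.le, hΛC⟩)
  -- Subadditivity of the square root: `b ^ 2 - a ^ 2 = Λ / 4 ^ (L - l)`.
  have hsub : b - a ≤ √Λ / 2 ^ (L - l) := by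
    rw [sub_le_iff_le_add]
    refine Real.sqrt_le_iff.2 ⟨by positivity, ?_⟩
    have h1 : (√Λ / 2 ^ (L - l)) ^ 2 = Λ * (1 / 4 ^ (L - l)) := by
      rw [div_pow, Real.sq_sqrt hΛ0, h4]; ring
    have h2 : a ^ 2 = Λ * (((ν : ℕ) : ℝ) / 4 ^ (L - l)) := Real.sq_sqrt (by positivity)
    have h3 : 0 ≤ √Λ / 2 ^ (L - l) * a := by positivity
    rw [add_sq, h1, h2, add_div]
    linarith
  have hwidth : (b - a) * R < 7 := by
    calc (b - a) * R ≤ (√2 * 2 ^ L / 2 ^ (L - l)) * R := by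
          gcongr
          exact hsub.trans (by gcongr)
      _ = (√2 * √2) * Real.pi := by rw [hR, h2L]; field_simp
      _ < 7 := by rw [h22]; linarith [Real.pi_lt_d2]
  have hbR : b * R ≤ 2 * Real.pi * 2 ^ (L - l) := by
    calc b * R ≤ (√2 * 2 ^ L) * R := by gcongr; exact hbΛ.trans hsΛ
      _ = (√2 * √2) * Real.pi * 2 ^ (L - l) := by rw [hR, h2L]; field_simp
      _ = _ := by rw [h22]
  have hRle : R ≤ √2 * Real.pi := div_le_self (by positivity) (one_le_pow₀ (by norm_num))
  obtain ⟨r, hr, hr'⟩ := hC C₁ hb a b R (Real.sqrt_nonneg _) hab hbC (by positivity) hRle hwidth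
  have hblock : mhtBlockRank ε e m x l τ ν ≤ r := by
    refine HasSeparatedApprox.toNat_epsRank_le ?_
    have h := hr.mul_unimodular (fun ω => fourierKernel (boxCenter l τ) (ω : Plane))
      fun ω => norm_fourierKernel _ _
    refine h.comp (fun j => ⟨x j.1 - boxCenter l τ, ?_⟩) (fun k => ⟨latticePoint (e k.1), ?_⟩)
      fun j k => ?_
    · have h := norm_sub_boxCenter_le l (x j.1) (hx j.1)
      rw [show spaceBox l (x j.1) = τ from j.2] at h
      exact mem_closedBall_zero_iff.2 h
    · have h := torusEigenvalue_mem_freqBox e he (l := l) k.1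
      rw [k.2] at h
      exact h
    · simp only [mhtMatrix]
      rw [torusEigenfunction_eq, ← fourierKernel_add_left, sub_add_cancel]
  have hpow : max 1 ((b * R) ^ (2 / 3 : ℝ)) ≤
      (2 * Real.pi) ^ (2 / 3 : ℝ) * ((2 : ℝ) ^ (1 / 3 : ℝ)) ^ (2 * (L - l)) := by
    have e1 : ((2 : ℝ) ^ (1 / 3 : ℝ)) ^ (2 * (L - l)) = ((2 : ℝ) ^ (L - l)) ^ (2 / 3 : ℝ) := by
      rw [← Real.rpow_natCast, ← Real.rpow_natCast, ← Real.rpow_mul (by norm_num),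
        ← Real.rpow_mul (by norm_num)]
      congr 1
      push_cast
      ring
    rw [e1, ← Real.mul_rpow (by positivity) (by positivity)]
    have h1 : (1 : ℝ) ≤ 2 * Real.pi * 2 ^ (L - l) := by
      have : (1 : ℝ) ≤ 2 ^ (L - l) := one_le_pow₀ (by norm_num)
      nlinarith [Real.two_le_pi]
    refine max_le (Real.one_le_rpow h1 (by norm_num)) ?_
    gcongr
  calc (mhtBlockRank ε e m x l τ ν : ℝ) ≤ r := by exact_mod_cast hblock
    _ ≤ C * max 1 ((b * R) ^ (2 / 3 : ℝ)) := hr'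
    _ ≤ C * ((2 * Real.pi) ^ (2 / 3 : ℝ) * ((2 : ℝ) ^ (1 / 3 : ℝ)) ^ (2 * (L - l))) := by gcongr
    _ = _ := by ring

/-! ### The costs in terms of the ranks -/

theorem Fintype.sum_card_fiber {α β : Type*} [Fintype α] [Fintype β] [DecidableEq β]
    (f : α → β) : ∑ b, Fintype.card {a // f a = b} = Fintype.card α := by
  rw [← Fintype.card_sigma]
  exact Fintype.card_congr (Equiv.sigmaFiberEquiv f)

namespace ButterflyFactorization

variable {I J : Type} [Fintype I] [Fintype J] {L : ℕ} {rowBox : ∀ l : ℕ, I → SpaceBox l}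
  {colBox : ∀ l : ℕ, J → FreqBox L l} {r : ∀ l : ℕ, SpaceBox l → FreqBox L l → ℕ}

/-- The number of entries of the transfer matrices from level `l` to level `l + 1`. -/
def transferStorage (F : ButterflyFactorization L rowBox colBox r) (l : ℕ) : ℕ :=
  ∑ τ, ∑ ν, entries (F.R l τ ν)

theorem steps_coefficients (F : ButterflyFactorization L rowBox colBox r) (c : J → ℂ) (l : ℕ) :
    (F.coefficients c l).steps =
      2 * ((∑ τ, ∑ ν, entries (F.V τ ν)) + ∑ k ∈ Finset.range l, F.transferStorage k) := by
  induction l with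
  | zero =>
    simp only [coefficients, Counted.all, matVec, entries, Finset.range_zero, Finset.sum_empty,
      add_zero, Finset.mul_sum]
    refine Finset.sum_congr rfl fun τ _ => Finset.sum_congr rfl fun ν _ => by ring
  | succ l ih =>
    rw [Finset.sum_range_succ, ← add_assoc, mul_add, ← ih]
    simp only [coefficients, Counted.bind, Counted.all, matVec, transferStorage, entries,
      Finset.mul_sum]
    congr 1
    refine Finset.sum_congr rfl fun τ _ => Finset.sum_congr rfl fun ν _ => by ring

/-- Each stored entry takes part in exactly one dense product; the final gathering of the output is
free. -/
theorem steps_apply (F : ButterflyFactorization L rowBox colBox r) (c : J → ℂ) :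
    (F.apply c).steps = 2 * F.storage := by
  simp only [apply, Counted.bind, steps_coefficients, Counted.all, matVec, storage, entries,
    transferStorage]
  rw [mul_add 2 (_ + _), Finset.mul_sum (s := (Finset.univ : Finset (SpaceBox L)))]
  ring_nf

theorem sum_entries_V_le (F : ButterflyFactorization L rowBox colBox r) {M : ℝ}
    (hr : ∀ τ ν, (r 0 τ ν : ℝ) ≤ M) :
    ((∑ τ, ∑ ν, entries (F.V τ ν) : ℕ) : ℝ) ≤ Fintype.card J * M := by
  have : Subsingleton (SpaceBox 0) := inferInstanceAs (Subsingleton (Fin 1 × Fin 1))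
  rw [← Fintype.sum_card_fiber (colBox 0)]
  push_cast
  rw [Fintype.sum_eq_single (default : SpaceBox 0) fun τ h => absurd (Subsingleton.elim _ _) h,
    Finset.sum_mul]
  refine Finset.sum_le_sum fun ν _ => ?_
  rw [entries, Fintype.card_fin]
  push_cast
  gcongr
  exact hr _ _

theorem sum_entries_U_le (F : ButterflyFactorization L rowBox colBox r) {M : ℝ}
    (hr : ∀ τ ν, (r L τ ν : ℝ) ≤ M) :
    ((∑ τ, entries (F.U τ) : ℕ) : ℝ) ≤ Fintype.card I * M := by
  rw [← Fintype.sum_card_fiber (rowBox L)]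
  push_cast
  rw [Finset.sum_mul]
  refine Finset.sum_le_sum fun ν _ => ?_
  rw [entries, Fintype.card_fin]
  push_cast
  gcongr
  exact hr _ _

/-- If the ranks at level `l` are bounded along the columns by `s`, and those at level `l + 1` by
`M`, the transfer matrices have at most `4 ^ (l + 1) * (∑ c, s c) * M` entries. -/
theorem transferStorage_le (F : ButterflyFactorization L rowBox colBox r) {l : ℕ} {M : ℝ}
    {s : FreqBox L l → ℝ} (hs : ∀ τ c, (r l τ c : ℝ) ≤ s c)
    (hr : ∀ τ ν, (r (l + 1) τ ν : ℝ) ≤ M) :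
    (F.transferStorage l : ℝ) ≤ 4 ^ (l + 1) * ((∑ c, s c) * M) := by
  have hτ : ∀ τ : SpaceBox (l + 1), ((∑ ν, entries (F.R l τ ν) : ℕ) : ℝ) ≤ (∑ c, s c) * M := by
    intro τ
    -- Every `c` has exactly one parent, so the heights of the transfer matrices of a fixed `τ` add
    -- up to a sum over all `c`.
    rw [← Fintype.sum_fiberwise (fun c : FreqBox L l => c.parent) s, Finset.sum_mul]
    push_cast
    refine Finset.sum_le_sum fun ν _ => ?_
    rw [entries, Fintype.card_sigma, Fintype.card_fin]
    push_cast
    have hnn : ∀ c, 0 ≤ s c := fun c => (Nat.cast_nonneg _).trans (hs τ.parent c)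
    simp only [Fintype.card_fin]
    gcongr with c
    · exact Finset.sum_nonneg fun c _ => hnn _
    · exact hs _ _
    · exact hr _ _
  have h := Finset.sum_le_sum fun (τ : SpaceBox (l + 1)) (_ : τ ∈ Finset.univ) => hτ τ
  rw [transferStorage]
  push_cast at h ⊢
  refine h.trans (le_of_eq ?_)
  rw [Finset.sum_const, Finset.card_univ, Fintype.card_prod, Fintype.card_fin, nsmul_eq_mul,
    ← mul_pow]
  norm_num

end ButterflyFactorization

/-- A sequence bounded by an increasing and by a decreasing geometric sequence. -/
theorem sum_range_le_of_le_geometric {T : ℕ → ℝ} {k L : ℕ} (hk : k ≤ L) {A B y : ℝ} (hy : 2 ≤ y)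
    (hA0 : 0 ≤ A) (hB0 : 0 ≤ B) (hA : ∀ l < L, T l ≤ A * y ^ l)
    (hB : ∀ l < L, T l ≤ B * y⁻¹ ^ l) :
    ∑ l ∈ Finset.range L, T l ≤ A * y ^ k + 2 * (B * y⁻¹ ^ k) := by
  have hy0 : 0 < y := by linarith
  rw [← Finset.sum_range_add_sum_Ico _ hk]
  have h1 : ∀ j : ℕ, ∑ l ∈ Finset.range j, y ^ l ≤ y ^ j := fun j => by
    induction j with
    | zero => simp
    | succ j ih =>
      rw [Finset.sum_range_succ, pow_succ]
      nlinarith [pow_pos hy0 j]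
  have hinv : y⁻¹ ≤ 1 / 2 := by
    rw [inv_eq_one_div]; gcongr
  have h2 : ∑ l ∈ Finset.Ico k L, y⁻¹ ^ l ≤ 2 * y⁻¹ ^ k := by
    refine (geom_sum_Ico_le_of_lt_one (by positivity) (by linarith)).trans ?_
    rw [div_le_iff₀ (by linarith)]
    nlinarith [pow_pos (inv_pos.2 hy0) k]
  have h3 : ∑ l ∈ Finset.range k, T l ≤ A * ∑ l ∈ Finset.range k, y ^ l := by
    rw [Finset.mul_sum]
    exact Finset.sum_le_sum fun l hl => hA l ((Finset.mem_range.1 hl).trans_le hk)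
  have h4 : ∑ l ∈ Finset.Ico k L, T l ≤ B * ∑ l ∈ Finset.Ico k L, y⁻¹ ^ l := by
    rw [Finset.mul_sum]
    exact Finset.sum_le_sum fun l hl => hB l (Finset.mem_Ico.1 hl).2
  have h5 := mul_le_mul_of_nonneg_left (h1 k) hA0
  have h6 := mul_le_mul_of_nonneg_left h2 hB0
  linarith

/-! ### Balancing the two rank bounds over the levels -/

theorem mhtBlockRank_le_card {ε : ℝ} (hε : 0 ≤ ε) (e : ℕ ≃ ℤ × ℤ) (m : ℕ) {n : ℕ}
    (x : Fin n → Plane) (l : ℕ) (τ : SpaceBox l) (ν : FreqBox (mhtLevels m) l) :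
    mhtBlockRank ε e m x l τ ν ≤ Fintype.card {k : Fin m // mhtColBox e m l k = ν} :=
  ENat.toNat_le_of_le_natCast (epsRank_le_card hε _)

theorem sum_transferStorage_le {ε C : ℝ} (hε : 0 < ε) (hC : 0 ≤ C) (e : ℕ ≃ ℤ × ℤ) (m : ℕ)
    {n : ℕ} (x : Fin n → Plane) (F : BFMHT ε e m x)
    (hr : ∀ l ≤ mhtLevels m, ∀ τ ν, (mhtBlockRank ε e m x l τ ν : ℝ) ≤
        C * ((2 : ℝ) ^ (1 / 3 : ℝ)) ^ (2 * (mhtLevels m - l))) :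
    ∑ l ∈ Finset.range (mhtLevels m), (F.transferStorage l : ℝ) ≤
      (4 * C + 24 * C ^ 2) * (2 ^ mhtLevels m) ^ 3 := by
  set L := mhtLevels m with hL
  set g := (2 : ℝ) ^ (1 / 3 : ℝ) with hg
  have hg3 : g ^ 3 = 2 := by
    rw [hg, ← Real.rpow_natCast, ← Real.rpow_mul (by norm_num)]; norm_num
  have hg1 : 1 ≤ g := Real.one_le_rpow (by norm_num) (by norm_num)
  have hg0 : 0 < g := by linarith
  -- All quantities become powers of `g`, so that the estimates reduce to arithmetic of exponents.
  have hg6 : (4 : ℝ) = g ^ 6 := by rw [show g ^ 6 = (g ^ 3) ^ 2 by ring, hg3]; norm_num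
  have hstep : ∀ l < L, ∀ τ ν, (mhtBlockRank ε e m x (l + 1) τ ν : ℝ) ≤ C * g ^ (2 * (L - l)) :=
    fun l hl τ ν => (hr (l + 1) hl τ ν).trans (by gcongr; omega)
  -- Effective for `l` below `L / 4`: the input ranks are bounded by the column counts, with sum `m
  -- ≤ 4 ^ L`.
  have hA : ∀ l < L, (F.transferStorage l : ℝ) ≤ (4 * C * g ^ (8 * L)) * (g ^ 4) ^ l := by
    intro l hl
    refine (F.transferStorage_le
      (fun τ c => Nat.cast_le.2 (mhtBlockRank_le_card hε.le e m x l τ c)) (hstep l hl)).trans ?_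
    rw [← Nat.cast_sum, Fintype.sum_card_fiber, Fintype.card_fin]
    have hm : (m : ℝ) ≤ 4 ^ L := by exact_mod_cast le_four_pow_mhtLevels m
    calc (4 : ℝ) ^ (l + 1) * (m * (C * g ^ (2 * (L - l))))
        ≤ 4 ^ (l + 1) * (4 ^ L * (C * g ^ (2 * (L - l)))) := by gcongr
      _ = 4 * C * (4 ^ l * 4 ^ L * g ^ (2 * (L - l))) := by ring
      _ = 4 * C * (g ^ (8 * L) * (g ^ 4) ^ l) := by
          rw [hg6, ← pow_mul, ← pow_mul, ← pow_mul, ← pow_add, ← pow_add, ← pow_add]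
          congr 2
          omega
      _ = _ := by ring
  -- Effective for `l` above `L / 4`: the rank bound is used for both dimensions.
  have hB : ∀ l < L, (F.transferStorage l : ℝ) ≤ (4 * C ^ 2 * g ^ (10 * L)) * (g ^ 4)⁻¹ ^ l := by
    intro l hl
    refine (F.transferStorage_le (hr l hl.le) (hstep l hl)).trans ?_
    rw [Finset.sum_const, Finset.card_univ, Fintype.card_fin, nsmul_eq_mul]
    push_cast
    rw [inv_pow, ← div_eq_mul_inv, le_div_iff₀ (by positivity)]
    refine le_of_eq ?_
    calc (4 : ℝ) ^ (l + 1) * (4 ^ (L - l) * (C * g ^ (2 * (L - l))) * (C * g ^ (2 * (L - l)))) *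
          (g ^ 4) ^ l
        = 4 * C ^ 2 * (4 ^ l * 4 ^ (L - l) * g ^ (2 * (L - l)) * g ^ (2 * (L - l)) *
          (g ^ 4) ^ l) := by ring
      _ = 4 * C ^ 2 * g ^ (10 * L) := by
          rw [hg6, ← pow_mul, ← pow_mul, ← pow_mul, ← pow_add, ← pow_add, ← pow_add, ← pow_add]
          congr 2
          omega
  have hy : 2 ≤ g ^ 4 := by nlinarith [hg3, pow_succ g 3]
  have hsum := sum_range_le_of_le_geometric (Nat.div_le_self L 4) hy (by positivity)
    (by positivity) hA hB
  have h9 : ((2 : ℝ) ^ L) ^ 3 = g ^ (9 * L) := by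
    rw [← hg3, ← pow_mul, ← pow_mul]; congr 1; ring
  have hlow : g ^ (8 * L) * (g ^ 4) ^ (L / 4) ≤ g ^ (9 * L) := by
    rw [← pow_mul, ← pow_add]
    exact pow_le_pow_right₀ hg1 (by omega)
  -- Rounding `L / 4` down loses at most `g ^ 3 = 2`, bounded by `3`.
  have hhigh : g ^ (10 * L) * (g ^ 4)⁻¹ ^ (L / 4) ≤ 3 * g ^ (9 * L) := by
    rw [inv_pow, ← div_eq_mul_inv, div_le_iff₀ (by positivity)]
    have h43 : g ^ 3 ≤ 3 := by linarith
    rw [mul_assoc, ← pow_mul, ← pow_add]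
    calc g ^ (10 * L) ≤ g ^ (3 + (9 * L + 4 * (L / 4))) := pow_le_pow_right₀ hg1 (by omega)
      _ = g ^ 3 * g ^ (9 * L + 4 * (L / 4)) := pow_add _ _ _
      _ ≤ _ := by gcongr
  rw [h9]
  have h1 := mul_le_mul_of_nonneg_left hlow (show 0 ≤ 4 * C by positivity)
  have h2 := mul_le_mul_of_nonneg_left hhigh (show 0 ≤ 8 * C ^ 2 by positivity)
  calc _ ≤ _ := hsum
    _ = 4 * C * (g ^ (8 * L) * (g ^ 4) ^ (L / 4)) +
        8 * C ^ 2 * (g ^ (10 * L) * (g ^ 4)⁻¹ ^ (L / 4)) := by ring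
    _ ≤ _ := by linarith

theorem exists_storage_const (ε C₂ : ℝ) (hε : 0 < ε) :
    ∃ C : ℝ, 0 < C ∧ ∀ C₁ : ℝ, 0 < C₁ → AnnulusDiskRankBound ε C₁ C₂ →
      ∀ e : ℕ ≃ ℤ × ℤ, Monotone (fun k => torusEigenvalue (e k)) →
      ∀ m n : ℕ, (m : ℝ) ≤ C₁ ^ 2 / Real.pi → ∀ x : Fin n → Plane,
      (∀ j i, x j i ∈ Set.Icc (-Real.pi) Real.pi) → ∀ F : BFMHT ε e m x,
      (F.storage : ℝ) ≤ C * ((n : ℝ) + (m : ℝ) ^ (3 / 2 : ℝ)) := by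
  obtain ⟨C, hC0, hC⟩ := exists_mhtBlockRank_const ε C₂ hε
  -- Row bases contribute `2 * C`, transfer matrices the middle term, column bases at most `C`; the
  -- `1` ensures positivity.
  refine ⟨2 * C + 8 * (4 * C + 24 * C ^ 2) + 1, by positivity,
    fun C₁ hC₁ hb e he m n hm x hx F => ?_⟩
  have hr := hC C₁ hC₁ hb e he m n hm x hx
  set L := mhtLevels m with hL
  set s := (m : ℝ) ^ (3 / 2 : ℝ) with hs
  have hs0 : 0 ≤ s := by positivity
  have hU : ((∑ τ, entries (F.U τ) : ℕ) : ℝ) ≤ n * C := by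
    have h := F.sum_entries_U_le (M := C) fun τ ν => by simpa [← hL] using hr L le_rfl τ ν
    rwa [Fintype.card_fin] at h
  have hV := F.sum_entries_V_le (hr 0 (Nat.zero_le _))
  rw [Fintype.card_fin] at hV
  have hT : ((∑ l ∈ Finset.range L, F.transferStorage l : ℕ) : ℝ) ≤
      8 * (4 * C + 24 * C ^ 2) * s ∧
      (m : ℝ) * (C * ((2 : ℝ) ^ (1 / 3 : ℝ)) ^ (2 * (L - 0))) ≤ 2 * C * s := by
    -- The bound `4 ^ L ≤ 4 * m` fails for `m = 0`, where `L = 0` and no transfer matrices occur.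
    rcases Nat.eq_zero_or_pos m with h0 | hpos
    · have hL0 : L = 0 := by rw [hL, h0]; simp [mhtLevels]
      have hm0 : (m : ℝ) = 0 := by exact_mod_cast h0
      rw [hL0, hm0, Finset.range_zero, Finset.sum_empty, Nat.cast_zero, zero_mul]
      exact ⟨by positivity, by positivity⟩
    · have h1 := sum_transferStorage_le hε hC0 e m x F hr
      have hm0 : (0 : ℝ) < m := by exact_mod_cast hpos
      have hsm : s = m * √m := by
        rw [hs, show (3 / 2 : ℝ) = 1 + 1 / 2 by norm_num, Real.rpow_add hm0, Real.rpow_one,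
          Real.sqrt_eq_rpow]
      have hsq : √(m : ℝ) ^ 2 = m := Real.sq_sqrt hm0.le
      have h2L : (2 : ℝ) ^ L ≤ 2 * √m := by
        refine le_of_sq_le_sq ?_ (by positivity)
        rw [mul_pow, hsq, ← pow_mul, mul_comm L, pow_mul]
        norm_num
        exact_mod_cast four_pow_mhtLevels_le hpos
      have hcube : ((2 : ℝ) ^ L) ^ 3 ≤ 8 * s := by
        calc ((2 : ℝ) ^ L) ^ 3 ≤ (2 * √m) ^ 3 := by gcongr
          _ = 8 * (√(m : ℝ) ^ 2 * √m) := by ring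
          _ = _ := by rw [hsq, hsm]
      -- The crude bound `g ^ 2 ≤ 2` suffices, since `m * 2 ^ L` is already of order `m ^ (3/2)`.
      have hgL : ((2 : ℝ) ^ (1 / 3 : ℝ)) ^ (2 * (L - 0)) ≤ 2 ^ L := by
        rw [pow_mul]
        refine pow_le_pow_left₀ (by positivity) ?_ _
        rw [← Real.rpow_natCast, ← Real.rpow_mul (by norm_num)]
        refine (Real.rpow_le_rpow_of_exponent_le (y := ((1 / 3 : ℝ) * (2 : ℕ))) (z := 1)
          (by norm_num) (by norm_num)).trans (by simp)
      constructor
      · push_cast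
        refine h1.trans ?_
        calc _ ≤ (4 * C + 24 * C ^ 2) * (8 * s) := by gcongr
          _ = _ := by ring
      · calc _ ≤ (m : ℝ) * (C * (2 * √m)) := by gcongr; exact hgL.trans h2L
          _ = _ := by rw [hsm]; ring
  have hstorage : (F.storage : ℝ) = ((∑ τ, ∑ ν, entries (F.V τ ν) : ℕ) : ℝ) +
      ((∑ l ∈ Finset.range L, F.transferStorage l : ℕ) : ℝ) +
      ((∑ τ, entries (F.U τ) : ℕ) : ℝ) := by
    rw [← Nat.cast_add, ← Nat.cast_add]
    rfl
  rw [hstorage]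
  have hn : (0 : ℝ) ≤ n := by positivity
  have h3 : 0 ≤ (C + 8 * (4 * C + 24 * C ^ 2) + 1) * n := by positivity
  nlinarith [hT.1, hT.2.trans' hV]

theorem mainTheorem6 (ε C₂ : ℝ) (hε : 0 < ε) :
    ∃ C₃ : ℝ, 0 < C₃ ∧
      ∀ C₁ : ℝ, 0 < C₁ → AnnulusDiskRankBound ε C₁ C₂ →
        ∀ e : ℕ ≃ ℤ × ℤ, Monotone (fun k => torusEigenvalue (e k)) →
          ∀ m n : ℕ, (m : ℝ) ≤ C₁ ^ 2 / Real.pi →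
            ∀ x : Fin n → Plane,
              (∀ j i, x j i ∈ Set.Icc (-Real.pi) Real.pi) →
                ∀ F : BFMHT ε e m x,
                  (F.storage : ℝ) ≤ C₃ * ((n : ℝ) + (m : ℝ) ^ (3 / 2 : ℝ)) ∧
                    ∀ c : Fin m → ℂ,
                      ((F.apply c).steps : ℝ) ≤ C₃ * ((n : ℝ) + (m : ℝ) ^ (3 / 2 : ℝ)) := by

  obtain ⟨C, hC, h⟩ := exists_storage_const ε C₂ hε
  refine ⟨2 * C, by positivity, fun C₁ hC₁ hb e he m n hm x hx F => ?_⟩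
  have hF := h C₁ hC₁ hb e he m n hm x hx F
  have h0 : (0 : ℝ) ≤ F.storage := Nat.cast_nonneg _
  refine ⟨by linarith, fun c => ?_⟩
  rw [F.steps_apply]
  push_cast
  linarith
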